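/- Let $G$ be a countable discrete group, let $X$ and $Y$ be compact metric spaces, and let $G\curvearrowright X$ and $G\curvearrowright Y$ be continuous actions such that $G\curvearrowright Y$ is an extension of $G\curvearrowright X$, i.e. there is a $G$-equivariant continuous surjection $Y\to X$. Suppose that $G\curvearrowright X$ is free and almost finite, that the set $E_G(Y)$ of extreme points of the convex set of $G$-invariant regular Borel probability measures on $Y$ is finite, and that $Y$ has finite covering dimension. Then $G\curvearrowright Y$ is free and almost finite. Here a free action $G\curvearrowright Z$ on a compact metric space is called \emph{almost finite} if for every integer $n\geq 1$, every finite set $K\subseteq G$ and every $\delta>0$ there are finitely many pairs $(V_i,S_i)_{i\in I}$, where $V_i\subseteq Z$ is open and $S_i\subseteq G$ is finite and nonempty, and subsets $S_i'\subseteq S_i$, such that (1) for each $i$ the sets $sV_i$ for $s\in S_i$ are pairwise disjoint, and the sets $S_iV_i$ for $i\in I$ are pairwise disjoint; (2) each $S_i$ is $(K,\delta)$-invariant, i.e. $|tS_i\,\Delta\, S_i|<\delta|S_i|$ for all $t\in K$, and $\operatorname{diam}(sV_i)<\delta$ for all $i\in I$ and $s\in S_i$; (3) $|S_i'|<|S_i|/n$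 for all $i\in I$, and $Z\setminus\bigsqcup_{i\in I}S_iV_i\prec\bigsqcup_{i\in I}S_i'V_i$. For $A,B\subseteq Z$, the relation $A\prec B$ means that for every closed set $C\subseteq A$ there are a finite collection $\mathcal U$ of open subsets of $Z$ covering $C$ and elements $s_U\in G$ for $U\in\mathcal U$ such that the sets $s_UU$ for $U\in\mathcal U$ are pairwise disjoint subsets of $B$. -/

import Mathlib

open MeasureTheory
open scoped Pointwise ENNReal

namespace TopDyn

/-- A tower `(V, S)`: the sets `s V` for `s ∈ S` are pairwise disjoint. -/
def IsTower {G X : Type*} [Group G] [MulAction G X] (V : Set X) (S : Finset G) : Prop :=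
  (S : Set G).PairwiseDisjoint fun s => s • V

/-- A castle: a (finite) family of towers `(V i, S i)` for which the sets `(S i) (V i)` are
pairwise disjoint. -/
structure IsCastle {G X ι : Type*} [Group G] [MulAction G X] (V : ι → Set X) (S : ι → Finset G) :
    Prop where
  tower : ∀ i, IsTower (V i) (S i)
  disjoint : Pairwise fun i j => Disjoint ((S i : Set G) • V i) ((S j : Set G) • V j)

/-- The (left) Følner condition: `F` is nonempty and `|tF ∆ F| < δ |F|` for all `t ∈ K`. -/
def IsInvariantShape {G : Type*} [Group G] (K : Finset G) (δ : ℝ) (F : Finset G) : Prop :=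
  F.Nonempty ∧ ∀ t ∈ K, ((symmDiff (t • (F : Set G)) (F : Set G)).ncard : ℝ) < δ * F.card

/-- The relation `A ≺ B`: every closed `C ⊆ A` is covered by a finite collection `𝒰` of open sets
which can be translated by group elements to pairwise disjoint subsets of `B`. -/
def Subequiv (G : Type*) {X : Type*} [Group G] [TopologicalSpace X] [MulAction G X]
    (A B : Set X) : Prop :=
  ∀ C : Set X, IsClosed C → C ⊆ A →
    ∃ (𝒰 : Finset (Set X)) (s : Set X → G),
      (∀ U ∈ 𝒰, IsOpen U) ∧ C ⊆ ⋃ U ∈ 𝒰, U ∧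
      (𝒰 : Set (Set X)).PairwiseDisjoint (fun U => s U • U) ∧
      ∀ U ∈ 𝒰, s U • U ⊆ B

/-- Almost finiteness of a (free) action on a compact metric space. -/
def AlmostFinite (G X : Type*) [Group G] [MetricSpace X] [MulAction G X] : Prop :=
  ∀ n : ℕ, 0 < n → ∀ (K : Finset G) (δ : ℝ), 0 < δ →
    ∃ (ι : Type) (_ : Finite ι) (V : ι → Set X) (S S' : ι → Finset G),
      IsCastle V S ∧
      (∀ i, IsOpen (V i)) ∧
      (∀ i, IsInvariantShape K δ (S i)) ∧
      (∀ i, ∀ s ∈ S i, Metric.diam (s • V i) < δ) ∧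
      (∀ i, S' i ⊆ S i) ∧
      (∀ i, ((S' i).card : ℝ) < (S i).card / n) ∧
      Subequiv G (⋃ i, (S i : Set G) • V i)ᶜ (⋃ i, (S' i : Set G) • V i)

/-- `π : Y → X` exhibits `G ↷ Y` as an extension of `G ↷ X`. -/
structure IsExtension (G : Type*) {X Y : Type*} [Group G] [TopologicalSpace X]
    [TopologicalSpace Y] [MulAction G X] [MulAction G Y] (π : Y → X) : Prop where
  continuous : Continuous π
  surjective : Function.Surjective π
  equivariant : ∀ (g : G) (y : Y), π (g • y) = g • π y

/-- The set `M_G(X)` of `G`-invariant regular Borel probability measures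
(for `X` carrying its Borel `σ`-algebra). -/
def invariantMeasures (G X : Type*) [Group G] [TopologicalSpace X] [MeasurableSpace X]
    [MulAction G X] : Set (Measure X) :=
  {μ | IsProbabilityMeasure μ ∧ μ.Regular ∧ SMulInvariantMeasure G X μ}

/-- The set `E_G(X)` of extreme points of `M_G(X)`. -/
noncomputable def ergodicMeasures (G X : Type*) [Group G] [TopologicalSpace X] [MeasurableSpace X]
    [MulAction G X] : Set (Measure X) :=
  Set.extremePoints ℝ≥0∞ (invariantMeasures G X)

/-- Lebesgue covering dimension at most `d`: every finite open cover has a finite open refinement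
such that each point lies in at most `d + 1` of its members. -/
def CoveringDimLE (X : Type*) [TopologicalSpace X] (d : ℕ) : Prop :=
  ∀ 𝒰 : Set (Set X), 𝒰.Finite → (∀ U ∈ 𝒰, IsOpen U) → ⋃₀ 𝒰 = Set.univ →
    ∃ 𝒱 : Set (Set X), 𝒱.Finite ∧ (∀ V ∈ 𝒱, IsOpen V) ∧ ⋃₀ 𝒱 = Set.univ ∧
      (∀ V ∈ 𝒱, ∃ U ∈ 𝒰, V ⊆ U) ∧
      ∀ x : X, {V ∈ 𝒱 | x ∈ V}.encard ≤ d + 1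

/-- Finite covering dimension. -/
def FiniteCoveringDim (X : Type*) [TopologicalSpace X] : Prop :=
  ∃ d : ℕ, CoveringDimLE X d

end TopDyn

/-! Castles pull back from `X` to `Y` along `π` with the same shapes, and so does the comparison of
the remainder with the sets `S' V`; only small diameter of the levels is lost. Since there are
finitely many ergodic measures, `Y` has a partition into small open sets up to a closed set that is
null for every invariant measure (`exists_null_partition`). Cutting each pulled-back tower according
to the partition pieces met by its levels makes the levels small, at the price of a closed null set
`N` of uncovered points (`exists_castle_of_isExtension`).

It remains to absorb `N`. In each tower `d + 1` spare levels are reserved, giving disjoint open sets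
`B k` whose invariant measures are bounded below. By `exists_invariantShape_visits_lt`, orbit
segments along sufficiently invariant shapes visit `N` rarely and every `B k` often. A second castle
pulled back from `X` therefore leaves, in each tower, more levels in `B k` than pieces of `N` to be
placed. Covering dimension `d` supplies `d + 1` disjoint families of open sets on which the
placement is constant, family `k` being sent into `B k` (`transports_of_tower`,
`transports_of_null`). -/

namespace TopDyn

/-! ### Invariant measures: reduction to ergodic ones, and visit frequencies. -/

section InvariantMeasures

open Filter Topology BoundedContinuousFunction

variable {G Y : Type*} [Group G] [MetricSpace Y] [MeasurableSpace Y] [BorelSpace Y]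

theorem upperSemicontinuous_measure_of_isClosed {C : Set Y} (hC : IsClosed C) :
    UpperSemicontinuous fun μ : ProbabilityMeasure Y => (μ : Measure Y) C := by
  intro μ c hc
  exact eventually_lt_of_limsup_lt
    ((ProbabilityMeasure.limsup_measure_closed_le_of_tendsto tendsto_id hC).trans_lt hc)

variable [CompactSpace Y] [MulAction G Y] [ContinuousConstSMul G Y]

theorem mem_invariantMeasures_iff (μ : ProbabilityMeasure Y) :
    (μ : Measure Y) ∈ invariantMeasures G Y ↔
      ∀ (g : G) (f : Y →ᵇ ℝ), ∫ y, f (g • y) ∂(μ : Measure Y) = ∫ y, f y ∂(μ : Measure Y) := by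
  constructor
  · rintro ⟨-, -, h⟩ g f
    exact integral_smul_eq_self (fun y => f y)
  · intro h
    refine ⟨inferInstance, inferInstance, ⟨fun g s hs => ?_⟩⟩
    have hmap : (μ : Measure Y).map (g • ·) = μ := by
      have : IsFiniteMeasure ((μ : Measure Y).map (g • ·)) := inferInstance
      refine ext_of_forall_integral_eq_of_IsFiniteMeasure fun f => ?_
      rw [integral_map (continuous_const_smul g).measurable.aemeasurable
        f.continuous.aestronglyMeasurable]
      exact h g f
    conv_rhs => rw [← hmap]
    rw [Measure.map_apply (continuous_const_smul g).measurable hs]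

variable (G Y) in
theorem isClosed_setOf_mem_invariantMeasures :
    IsClosed {μ : ProbabilityMeasure Y | (μ : Measure Y) ∈ invariantMeasures G Y} := by
  simp only [mem_invariantMeasures_iff, Set.ofPred_forall]
  refine isClosed_iInter fun g => isClosed_iInter fun f => isClosed_eq ?_ ?_
  · exact ProbabilityMeasure.continuous_integral_boundedContinuousFunction
      (f.compContinuous ⟨_, continuous_const_smul g⟩)
  · exact ProbabilityMeasure.continuous_integral_boundedContinuousFunction f

/-- The upper semicontinuous map `μ ↦ μ Z` attains its maximum over invariant measures on a compact
face. An extreme point of that face is ergodic, so the maximum is `0`. -/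
theorem measure_eq_zero_of_forall_ergodicMeasures {Z : Set Y} (hZ : IsClosed Z)
    (h : ∀ μ ∈ ergodicMeasures G Y, μ Z = 0) : ∀ μ ∈ invariantMeasures G Y, μ Z = 0 := by
  intro μ₀ hμ₀
  set M : Set (ProbabilityMeasure Y) := {μ | (μ : Measure Y) ∈ invariantMeasures G Y} with hM
  have hMc : IsCompact M := (isClosed_setOf_mem_invariantMeasures G Y).isCompact
  have husc := upperSemicontinuous_measure_of_isClosed hZ
  obtain ⟨m, hmM, hmax⟩ := (husc.upperSemicontinuousOn M).exists_isMaxOn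
    ⟨⟨μ₀, hμ₀.1⟩, hμ₀⟩ hMc
  set F : Set (ProbabilityMeasure Y) := M ∩ {μ | (m : Measure Y) Z ≤ (μ : Measure Y) Z} with hF
  have hFc : IsCompact F := hMc.inter_right (husc.isClosed_preimage _)
  -- Integration embeds the measures in a locally convex space, where a nonempty compact set has
  -- extreme points.
  let Φ : ProbabilityMeasure Y → ((Y →ᵇ ℝ) → ℝ) := fun μ f => ∫ y, f y ∂(μ : Measure Y)
  have hΦ : Continuous Φ := continuous_pi fun f =>
    ProbabilityMeasure.continuous_integral_boundedContinuousFunction f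
  have hinj : Function.Injective Φ := fun μ ν hμν => Subtype.ext
    (ext_of_forall_integral_eq_of_IsFiniteMeasure (μ := (μ : Measure Y)) (ν := (ν : Measure Y))
      fun f => congrFun hμν f)
  obtain ⟨_, ⟨μ, hμF, rfl⟩, hext⟩ := (hFc.image hΦ).extremePoints_nonempty
    ⟨_, m, ⟨hmM, le_refl ((m : Measure Y) Z)⟩, rfl⟩
  have herg : (μ : Measure Y) ∈ ergodicMeasures G Y := by
    refine mem_extremePoints_iff_left.2 ⟨hμF.1, fun ν₁ hν₁ ν₂ hν₂ hseg => ?_⟩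
    obtain ⟨a, b, ha, hb, hab, hμ⟩ := hseg
    have := hν₁.1
    have := hν₂.1
    have ha1 : a ≠ ∞ := fun h => by simp [h] at hab
    have hb1 : b ≠ ∞ := fun h => by simp [h] at hab
    have hle₁ : ν₁ Z ≤ (m : Measure Y) Z :=
      hmax (show (⟨ν₁, hν₁.1⟩ : ProbabilityMeasure Y) ∈ M from hν₁)
    have hle₂ : ν₂ Z ≤ (m : Measure Y) Z :=
      hmax (show (⟨ν₂, hν₂.1⟩ : ProbabilityMeasure Y) ∈ M from hν₂)
    have hsum : a.toReal + b.toReal = 1 := by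
      rw [← ENNReal.toReal_add ha1 hb1, hab, ENNReal.toReal_one]
    have hapos := ENNReal.toReal_pos ha.ne' ha1
    have hbpos := ENNReal.toReal_pos hb.ne' hb1
    have hZeq : a.toReal * ν₁.real Z + b.toReal * ν₂.real Z = (μ : Measure Y).real Z := by
      simp only [← hμ, measureReal_def, Measure.add_apply, Measure.smul_apply, smul_eq_mul]
      rw [ENNReal.toReal_add (ENNReal.mul_ne_top ha1 (measure_ne_top _ _))
        (ENNReal.mul_ne_top hb1 (measure_ne_top _ _)), ENNReal.toReal_mul, ENNReal.toReal_mul]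
    have hm : (m : Measure Y).real Z ≤ (μ : Measure Y).real Z :=
      ENNReal.toReal_mono (measure_ne_top _ _) hμF.2
    have h1 : ν₁.real Z ≤ (m : Measure Y).real Z := ENNReal.toReal_mono (measure_ne_top _ _) hle₁
    have h2 : ν₂.real Z ≤ (m : Measure Y).real Z := ENNReal.toReal_mono (measure_ne_top _ _) hle₂
    have hmm : a.toReal * (m : Measure Y).real Z + b.toReal * (m : Measure Y).real Z =
        (m : Measure Y).real Z := by rw [← add_mul, hsum, one_mul]
    have e1 : (m : Measure Y).real Z ≤ ν₁.real Z := by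
      refine le_of_mul_le_mul_left ?_ hapos
      linarith [mul_le_mul_of_nonneg_left h2 hbpos.le]
    have e2 : (m : Measure Y).real Z ≤ ν₂.real Z := by
      refine le_of_mul_le_mul_left ?_ hbpos
      linarith [mul_le_mul_of_nonneg_left h1 hapos.le]
    have f1 : (⟨ν₁, hν₁.1⟩ : ProbabilityMeasure Y) ∈ F :=
      ⟨hν₁, (ENNReal.toReal_le_toReal (measure_ne_top _ _) (measure_ne_top ν₁ _)).1 e1⟩
    have f2 : (⟨ν₂, hν₂.1⟩ : ProbabilityMeasure Y) ∈ F :=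
      ⟨hν₂, (ENNReal.toReal_le_toReal (measure_ne_top _ _) (measure_ne_top ν₂ _)).1 e2⟩
    have key := hext (Set.mem_image_of_mem Φ f1) (Set.mem_image_of_mem Φ f2)
      ⟨a.toReal, b.toReal, hapos, hbpos, hsum, by
        funext f
        change a.toReal * ∫ y, f y ∂ν₁ + b.toReal * ∫ y, f y ∂ν₂ = ∫ y, f y ∂(μ : Measure Y)
        rw [← hμ, integral_add_measure ((f.integrable ν₁).smul_measure ha1)
          ((f.integrable ν₂).smul_measure hb1), integral_smul_measure, integral_smul_measure]
        rfl⟩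
    exact congrArg Subtype.val (hinj key)
  have := h _ herg
  exact le_antisymm ((hmax (show (⟨μ₀, hμ₀.1⟩ : ProbabilityMeasure Y) ∈ M from hμ₀)).trans
    (hμF.2.trans this.le)) bot_le

theorem abs_sum_sub_sum_le_card_symmDiff {α : Type*} [DecidableEq α] (A B : Finset α) (h : α → ℝ)
    {c : ℝ} (hc : ∀ a, |h a| ≤ c) :
    |∑ a ∈ A, h a - ∑ a ∈ B, h a| ≤ c * (symmDiff A B).card := by
  rw [← Finset.sum_sdiff_sub_sum_sdiff]
  have hb : ∀ D : Finset α, |∑ a ∈ D, h a| ≤ c * D.card := fun D =>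
    (Finset.abs_sum_le_sum_abs _ _).trans <| by
      simpa [mul_comm] using Finset.sum_le_card_nsmul D _ c fun a _ => hc a
  have hcard : (symmDiff A B).card = (A \ B).card + (B \ A).card := by
    rw [symmDiff_def, Finset.sup_eq_union, Finset.card_union_of_disjoint disjoint_sdiff_sdiff]
  rw [hcard]
  push_cast
  have h1 := hb (A \ B)
  have h2 := hb (B \ A)
  refine (abs_sub _ _).trans ?_
  linarith

/-- Krylov–Bogolyubov: otherwise the uniform measures on orbit segments along ever more invariant
shapes have an ultrafilter limit that is invariant and gives the closed set `C` mass at least `ε`.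
-/
theorem exists_invariantShape_visits_lt {C : Set Y} (hC : IsClosed C) {ε : ℝ}
    (h : ∀ μ ∈ invariantMeasures G Y, μ.real C < ε) :
    ∃ (K : Finset G) (δ : ℝ), 0 < δ ∧ ∀ F : Finset G, IsInvariantShape K δ F →
      ∀ y : Y, (({s ∈ (F : Set G) | s • y ∈ C}.ncard : ℕ) : ℝ) < ε * F.card := by
  classical
  by_contra! hcon
  have hcon' : ∀ p : Finset G × ℕ, ∃ F : Finset G, IsInvariantShape p.1 (1 / (p.2 + 1 : ℝ)) F ∧
      ∃ y : Y, ε * F.card ≤ (({s ∈ (F : Set G) | s • y ∈ C}.ncard : ℕ) : ℝ) := fun p =>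
    hcon p.1 _ (by positivity)
  choose F hF y hy using hcon'
  have hcard : ∀ p, (0 : ℝ) < (F p).card := fun p => by exact_mod_cast (hF p).1.card_pos
  let ν₀ : Finset G × ℕ → Measure Y := fun p =>
    ((F p).card : ℝ≥0∞)⁻¹ • ∑ s ∈ F p, Measure.dirac (s • y p)
  have hν₀ : ∀ p, IsProbabilityMeasure (ν₀ p) := fun p => ⟨by
    simp only [ν₀, Measure.smul_apply, Measure.coe_finsetSum, Finset.sum_apply, measure_univ,
      Finset.sum_const, nsmul_eq_mul, mul_one, smul_eq_mul]
    exact ENNReal.inv_mul_cancel (by simpa using (hF p).1.ne_empty) (by simp)⟩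
  let ν : Finset G × ℕ → ProbabilityMeasure Y := fun p => ⟨ν₀ p, hν₀ p⟩
  have hint : ∀ p (f : Y →ᵇ ℝ), ∫ z, f z ∂(ν p : Measure Y) =
      (∑ s ∈ F p, f (s • y p)) / (F p).card := fun p f => by
    change ∫ z, f z ∂(ν₀ p) = _
    rw [integral_smul_measure, integral_finsetSum_measure (fun s _ => f.integrable _)]
    simp [integral_dirac, div_eq_inv_mul]
  have hmeas : ∀ p, ε ≤ (ν p : Measure Y).real C := fun p => by
    change ε ≤ (ν₀ p C).toReal
    have : ν₀ p C = ((F p).card : ℝ≥0∞)⁻¹ *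
        (({s ∈ (F p : Set G) | s • y p ∈ C}.ncard : ℕ) : ℝ≥0∞) := by
      have e : {s ∈ (F p : Set G) | s • y p ∈ C} =
          (((F p).filter fun s => s • y p ∈ C : Finset G) : Set G) := by ext; simp
      rw [e, Set.ncard_coe_finset]
      simp [ν₀, Measure.dirac_apply' _ hC.measurableSet, Set.indicator_apply,
        Finset.sum_boole]
    rw [this, ENNReal.toReal_mul, ENNReal.toReal_inv, ENNReal.toReal_natCast,
      ENNReal.toReal_natCast, ← div_eq_inv_mul, le_div_iff₀ (hcard p)]
    exact hy p
  let 𝓕 : Ultrafilter (Finset G × ℕ) := Ultrafilter.of atTop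
  have h𝓕 : (𝓕 : Filter (Finset G × ℕ)) ≤ atTop := Ultrafilter.of_le _
  obtain ⟨μ, -, hμ⟩ := isCompact_univ.ultrafilter_le_nhds (𝓕.map ν) (by simp)
  have hlim : Tendsto ν 𝓕 (𝓝 μ) := hμ
  have hinv : (μ : Measure Y) ∈ invariantMeasures G Y := by
    refine (mem_invariantMeasures_iff μ).2 fun g f => ?_
    have t1 := (ProbabilityMeasure.tendsto_iff_forall_integral_tendsto.1 hlim)
      (f.compContinuous ⟨_, continuous_const_smul g⟩)
    have t2 := (ProbabilityMeasure.tendsto_iff_forall_integral_tendsto.1 hlim) f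
    refine sub_eq_zero.1 (tendsto_nhds_unique (t1.sub t2) ?_)
    have t3 : Tendsto (fun p : Finset G × ℕ => ‖f‖ * (1 / ((p.2 : ℝ) + 1))) 𝓕 (𝓝 0) := by
      have : Tendsto (fun p : Finset G × ℕ => p.2) atTop atTop := by
        rw [← prod_atTop_atTop_eq]
        exact tendsto_snd
      simpa using ((tendsto_one_div_add_atTop_nhds_zero_nat (𝕜 := ℝ)).comp
        (this.mono_left h𝓕)).const_mul ‖f‖
    refine squeeze_zero_norm' ?_ t3
    have hev : ∀ᶠ p : Finset G × ℕ in 𝓕, g ∈ p.1 := h𝓕 <| by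
      filter_upwards [eventually_ge_atTop (({g}, 0) : Finset G × ℕ)] with p hp
      exact hp.1 (by simp)
    filter_upwards [hev] with p hp
    rw [hint, hint, ← sub_div, Real.norm_eq_abs, abs_div, abs_of_pos (hcard p),
      div_le_iff₀ (hcard p)]
    have hsum : ∑ s ∈ F p, (f.compContinuous ⟨_, continuous_const_smul g⟩) (s • y p) =
        ∑ s ∈ g • F p, f (s • y p) := by
      rw [← Finset.image_smul, Finset.sum_image (by simp)]
      simp [mul_smul]
    rw [hsum]
    refine (abs_sum_sub_sum_le_card_symmDiff (g • F p) (F p) (fun s => f (s • y p))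
      (c := ‖f‖) fun s => f.norm_coe_le_norm _).trans ?_
    have := (hF p).2 g hp
    rw [← Finset.coe_smul_finset, ← Finset.coe_symmDiff, Set.ncard_coe_finset] at this
    rw [mul_assoc]
    exact mul_le_mul_of_nonneg_left this.le (norm_nonneg _)
  have hlow : ENNReal.ofReal ε ≤ (μ : Measure Y) C :=
    le_trans (le_limsup_of_frequently_le' (Frequently.of_forall fun p =>
      (ENNReal.ofReal_le_iff_le_toReal (measure_ne_top _ _)).2 (hmeas p)))
      (ProbabilityMeasure.limsup_measure_closed_le_of_tendsto hlim hC)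
  have := (ENNReal.ofReal_le_iff_le_toReal (measure_ne_top _ _)).1 hlow
  exact absurd (h _ hinv) (not_lt.2 this)

end InvariantMeasures

/-! ### Small open partitions with universally null complement. -/

section NullPartition

variable {G Y : Type*} [Group G] [MetricSpace Y] [CompactSpace Y] [MulAction G Y]
  [ContinuousConstSMul G Y] [MeasurableSpace Y] [BorelSpace Y]

/-- Spheres of distinct radii about `y` are disjoint, so each ergodic measure charges only countably
many of them. -/
theorem exists_null_sphere (hE : (ergodicMeasures G Y).Finite) (y : Y) {δ : ℝ} (hδ : 0 < δ) :
    ∃ r ∈ Set.Ioo 0 δ, ∀ μ ∈ invariantMeasures G Y, μ (Metric.sphere y r) = 0 := by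
  have hc : (⋃ μ ∈ ergodicMeasures G Y, {r : ℝ | 0 < μ (Metric.sphere y r)}).Countable := by
    refine hE.countable.biUnion fun μ hμ => ?_
    have := hμ.1.1
    refine Measure.countable_meas_pos_of_disjoint_iUnion
      (fun r => Metric.isClosed_sphere.measurableSet) fun r r' hr => ?_
    refine Set.disjoint_left.2 fun z hz hz' => hr ?_
    rw [← Metric.mem_sphere.1 hz, Metric.mem_sphere.1 hz']
  obtain ⟨r, hr, hr0⟩ := (hc.dense_compl ℝ).exists_between hδ
  refine ⟨r, hr0, measure_eq_zero_of_forall_ergodicMeasures Metric.isClosed_sphere fun μ hμ => ?_⟩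
  by_contra h0
  exact hr (Set.mem_biUnion hμ (pos_iff_ne_zero.2 h0))

theorem exists_null_partition (hE : (ergodicMeasures G Y).Finite) {δ : ℝ} (hδ : 0 < δ) :
    ∃ (m : ℕ) (P : Fin m → Set Y), (∀ i, IsOpen (P i)) ∧
      (Pairwise fun i j => Disjoint (P i) (P j)) ∧ (∀ i, Metric.diam (P i) < δ) ∧
      ∀ μ ∈ invariantMeasures G Y, μ (⋃ i, P i)ᶜ = 0 := by
  choose r hr hnull using fun y : Y => exists_null_sphere hE y (half_pos hδ)
  obtain ⟨t, ht⟩ := CompactSpace.elim_nhds_subcover (fun y => Metric.ball y (r y))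
    fun y => Metric.ball_mem_nhds y (hr y).1
  let c : Fin t.card → Y := fun i => (t.equivFin.symm i : Y)
  let P : Fin t.card → Set Y := fun i =>
    Metric.ball (c i) (r (c i)) \ ⋃ j : Fin t.card, ⋃ _ : j < i, Metric.closedBall (c j) (r (c j))
  have hdisj : ∀ i j, i < j → Disjoint (P i) (P j) := fun i j hij =>
    Set.disjoint_left.2 fun z hz hz' => hz'.2 <|
      Set.mem_biUnion (show j > i from hij) (Metric.ball_subset_closedBall hz.1)
  refine ⟨t.card, P, fun i => ?_, fun i j hij => ?_, fun i => ?_, fun μ hμ => ?_⟩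
  · exact Metric.isOpen_ball.sdiff (isClosed_iUnion_of_finite fun j =>
      isClosed_iUnion_of_finite fun _ => Metric.isClosed_closedBall)
  · rcases lt_or_gt_of_ne hij with h | h
    · exact hdisj i j h
    · exact (hdisj j i h).symm
  · calc Metric.diam (P i) ≤ Metric.diam (Metric.ball (c i) (r (c i))) :=
          Metric.diam_mono Set.sdiff_subset Metric.isBounded_ball
      _ ≤ 2 * r (c i) := Metric.diam_ball (hr _).1.le
      _ < δ := by linarith [(hr (c i)).2]
  · refine measure_mono_null (t := ⋃ i, Metric.sphere (c i) (r (c i))) (fun z hz => ?_)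
      (measure_iUnion_null fun i => hnull _ μ hμ)
    have hex : ∃ i, z ∈ Metric.closedBall (c i) (r (c i)) := by
      have : z ∈ ⋃ y ∈ t, Metric.ball y (r y) := by rw [ht]; trivial
      obtain ⟨y, hy, hzy⟩ := Set.mem_iUnion₂.1 this
      refine ⟨t.equivFin ⟨y, hy⟩, Metric.ball_subset_closedBall ?_⟩
      simpa [c] using hzy
    -- For the first closed ball containing `z`, either `z` is on its sphere or `z` lies in `P i`.
    obtain ⟨i, hi, hmin⟩ := WellFounded.has_min (wellFounded_lt (α := Fin t.card)) _ hex
    refine Set.mem_iUnion.2 ⟨i, ?_⟩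
    by_contra hs
    refine hz (Set.mem_iUnion.2 ⟨i, ?_, ?_⟩)
    · exact lt_of_le_of_ne hi hs
    · simp only [Set.mem_iUnion, not_exists]
      exact fun j hj hz' => hmin j hz' hj

end NullPartition

/-! ### Colourings from covering dimension. -/

theorem CoveringDimLE.exists_coloring {Y : Type*} [MetricSpace Y] {d : ℕ} (h : CoveringDimLE Y d)
    {𝒪 : Set (Set Y)} (hfin : 𝒪.Finite) (hopen : ∀ U ∈ 𝒪, IsOpen U) (hcov : ⋃₀ 𝒪 = Set.univ) :
    ∃ 𝒲 : Fin (d + 1) → Set (Set Y), (∀ k, (𝒲 k).Finite) ∧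
      (∀ k, ∀ W ∈ 𝒲 k, IsOpen W ∧ ∃ U ∈ 𝒪, W ⊆ U) ∧ (∀ k, (𝒲 k).PairwiseDisjoint id) ∧
      ∀ y, ∃ k, ∃ W ∈ 𝒲 k, y ∈ W := by
  classical
  obtain ⟨𝒱, hVfin, hVo, hVcov, hVref, hVord⟩ := h 𝒪 hfin hopen hcov
  lift 𝒱 to Finset (Set Y) using hVfin
  let φ : Set Y → Y → ℝ≥0∞ := fun V y => Metric.infEDist y Vᶜ
  have hφ : ∀ V, Continuous (φ V) := fun V => Metric.continuous_infEDist
  have hφpos : ∀ V ∈ 𝒱, ∀ y, 0 < φ V y ↔ y ∈ V := fun V hV y => by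
    rw [pos_iff_ne_zero, ne_eq, ← Metric.mem_closure_iff_infEDist_zero,
      (hVo V hV).isClosed_compl.closure_eq, Set.mem_compl_iff, not_not]
  -- `W σ` is where the depths `φ V`, `V ∈ σ`, all exceed those of the other members. Distinct `σ`
  -- of equal size are incomparable, so their `W σ` are disjoint; size is the colour.
  let W : Finset (Set Y) → Set Y := fun σ =>
    (⋂ V ∈ σ, V) ∩ ⋂ V ∈ σ, ⋂ V' ∈ 𝒱 \ σ, {y | φ V' y < φ V y}
  refine ⟨fun k => W '' {σ | σ ⊆ 𝒱 ∧ σ.card = k + 1}, fun k => ?_, ?_, fun k => ?_, fun y => ?_⟩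
  · refine Set.Finite.image _ ((𝒱.powerset.finite_toSet).subset fun σ hσ => ?_)
    simpa using hσ.1
  · rintro k _ ⟨σ, ⟨hσ, hcard⟩, rfl⟩
    constructor
    · refine (isOpen_biInter_finset fun V hV => hVo V (hσ hV)).inter
        (isOpen_biInter_finset fun V _ => isOpen_biInter_finset fun V' _ => ?_)
      exact isOpen_lt (hφ V') (hφ V)
    · obtain ⟨V, hV⟩ := Finset.card_pos.1 (by omega : 0 < σ.card)
      obtain ⟨U, hU, hVU⟩ := hVref V (hσ hV)
      exact ⟨U, hU, fun y hy => hVU (Set.mem_iInter₂.1 hy.1 V hV)⟩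
  · rintro _ ⟨σ, ⟨hσ, hσc⟩, rfl⟩ _ ⟨τ, ⟨hτ, hτc⟩, rfl⟩ hne
    have hστ : σ ≠ τ := fun e => hne (by rw [e])
    obtain ⟨V, hV⟩ : (σ \ τ).Nonempty := by
      rw [Finset.sdiff_nonempty]
      exact fun hs => hστ (Finset.eq_of_subset_of_card_le hs (by omega))
    obtain ⟨V', hV'⟩ : (τ \ σ).Nonempty := by
      rw [Finset.sdiff_nonempty]
      exact fun hs => hστ (Finset.eq_of_subset_of_card_le hs (by omega)).symm
    rw [Finset.mem_sdiff] at hV hV'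
    refine Set.disjoint_left.2 fun y hy hy' => ?_
    have h1 := Set.mem_iInter₂.1 (Set.mem_iInter₂.1 hy.2 V hV.1) V'
      (Finset.mem_sdiff.2 ⟨hτ hV'.1, hV'.2⟩)
    have h2 := Set.mem_iInter₂.1 (Set.mem_iInter₂.1 hy'.2 V' hV'.1) V
      (Finset.mem_sdiff.2 ⟨hσ hV.1, hV.2⟩)
    exact lt_asymm (show φ V' y < φ V y from h1) h2
  · obtain ⟨V₀, hV₀, hyV₀⟩ : y ∈ ⋃₀ (𝒱 : Set (Set Y)) := by rw [hVcov]; trivial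
    obtain ⟨V₁, hV₁, hmax⟩ := 𝒱.exists_max_image (fun V => φ V y) ⟨V₀, hV₀⟩
    have hpos : 0 < φ V₁ y := ((hφpos V₀ hV₀ y).2 hyV₀).trans_le (hmax V₀ hV₀)
    -- The members of maximal depth at `y` all contain `y`, so there are at most `d + 1` of them.
    let σ : Finset (Set Y) := 𝒱.filter fun V => φ V y = φ V₁ y
    have hσmem : ∀ V ∈ σ, y ∈ V := fun V hV => by
      rw [Finset.mem_filter] at hV
      exact (hφpos V hV.1 y).1 (by rw [hV.2]; exact hpos)
    have hσpos : 0 < σ.card := Finset.card_pos.2 ⟨V₁, by simp [σ, hV₁]⟩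
    have hσle : σ.card ≤ d + 1 := by
      have h1 : ((σ : Set (Set Y))).encard ≤ d + 1 := by
        refine (Set.encard_le_encard fun V hV => ?_).trans (hVord y)
        exact ⟨(Finset.mem_filter.1 hV).1, hσmem V hV⟩
      rw [Set.encard_coe_eq_coe_finsetCard] at h1
      exact_mod_cast h1
    refine ⟨⟨σ.card - 1, by omega⟩, W σ, ⟨σ, ⟨Finset.filter_subset _ _, ?_⟩, rfl⟩, ?_, ?_⟩
    · simp only
      omega
    · exact Set.mem_iInter₂.2 hσmem
    · refine Set.mem_iInter₂.2 fun V hV => Set.mem_iInter₂.2 fun V' hV' => ?_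
      rw [Finset.mem_sdiff] at hV'
      have hne : φ V' y ≠ φ V₁ y := fun e => hV'.2 (Finset.mem_filter.2 ⟨hV'.1, e⟩)
      change φ V' y < φ V y
      rw [(Finset.mem_filter.1 hV).2]
      exact lt_of_le_of_ne (hmax V' hV'.1) hne

/-- The set `C` is covered by finitely many open sets which can be translated by elements of `G`
to pairwise disjoint subsets of `B`. -/
def Transports (G : Type*) {X : Type*} [Group G] [TopologicalSpace X] [MulAction G X]
    (C B : Set X) : Prop :=
  ∃ (ι : Type) (_ : Finite ι) (U : ι → Set X) (s : ι → G), (∀ i, IsOpen (U i)) ∧ C ⊆ ⋃ i, U i ∧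
    (Pairwise fun i j => Disjoint (s i • U i) (s j • U j)) ∧ ∀ i, s i • U i ⊆ B

/-! ### Calculus of `Transports` and its relation to `Subequiv`. -/

section Transports

variable {G X : Type*} [Group G] [TopologicalSpace X] [MulAction G X] {A B C D : Set X}

theorem Transports.of_finite {ι : Type*} [Finite ι] (U : ι → Set X) (s : ι → G)
    (hU : ∀ i, IsOpen (U i)) (hC : C ⊆ ⋃ i, U i)
    (hd : Pairwise fun i j => Disjoint (s i • U i) (s j • U j)) (hB : ∀ i, s i • U i ⊆ B) :
    Transports G C B := by
  let e := Finite.equivFin ι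
  refine ⟨Fin (Nat.card ι), inferInstance, U ∘ e.symm, s ∘ e.symm, fun i => hU _, ?_,
    fun i j hij => hd (e.symm.injective.ne hij), fun i => hB _⟩
  rwa [← e.symm.surjective.iUnion_comp] at hC

theorem Transports.mono (h : Transports G C B) (hC : D ⊆ C) (hB : B ⊆ A) : Transports G D A := by
  obtain ⟨ι, hι, U, s, hU, hcov, hd, hsub⟩ := h
  exact ⟨ι, hι, U, s, hU, hC.trans hcov, hd, fun i => (hsub i).trans hB⟩

theorem Transports.union (h₁ : Transports G C A) (h₂ : Transports G D B) (hAB : Disjoint A B) :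
    Transports G (C ∪ D) (A ∪ B) := by
  obtain ⟨ι, hι, U, s, hU, hcov, hd, hsub⟩ := h₁
  obtain ⟨κ, hκ, V, t, hV, hcov', hd', hsub'⟩ := h₂
  refine ⟨ι ⊕ κ, inferInstance, Sum.elim U V, Sum.elim s t, ?_, ?_, ?_, ?_⟩
  · rintro (i | i)
    exacts [hU i, hV i]
  · rw [Set.iUnion_sum]
    exact Set.union_subset_union hcov hcov'
  · rintro (i | i) (j | j) hij
    · exact hd fun e => hij (by rw [e])
    · exact hAB.mono (hsub i) (hsub' j)
    · exact (hAB.mono (hsub j) (hsub' i)).symm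
    · exact hd' fun e => hij (by rw [e])
  · rintro (i | i)
    · exact (hsub i).trans Set.subset_union_left
    · exact (hsub' i).trans Set.subset_union_right

theorem Transports.subequiv (h : Transports G A B) : Subequiv G A B := by
  classical
  intro C _ hCA
  obtain ⟨ι, hι, U, s, hU, hcov, hd, hsub⟩ := h
  have hfin : (Set.range U).Finite := Set.finite_range U
  -- Equal sets may carry several indices; one translating element is kept for each set.
  have hex : ∀ V : Set X, ∃ g : G, V ∈ Set.range U → ∃ i, U i = V ∧ s i = g := fun V => by
    by_cases hV : V ∈ Set.range U
    · obtain ⟨i, hi⟩ := hV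
      exact ⟨s i, fun _ => ⟨i, hi, rfl⟩⟩
    · exact ⟨1, fun h => absurd h hV⟩
  choose g hg using hex
  refine ⟨hfin.toFinset, g, ?_, ?_, ?_, ?_⟩
  · intro V hV
    obtain ⟨i, rfl⟩ := hfin.mem_toFinset.1 hV
    exact hU i
  · refine hCA.trans (hcov.trans (Set.iUnion_subset fun i => ?_))
    exact Set.subset_biUnion_of_mem (u := fun V : Set X => V) (by simp)
  · intro V hV V' hV' hne
    rw [hfin.coe_toFinset] at hV hV'
    obtain ⟨i, rfl, hi⟩ := hg V hV
    obtain ⟨j, rfl, hj⟩ := hg V' hV'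
    change Disjoint (g (U i) • U i) (g (U j) • U j)
    rw [← hi, ← hj]
    exact hd fun e => hne (by rw [e])
  · intro V hV
    obtain ⟨i, rfl, hi⟩ := hg V (hfin.mem_toFinset.1 hV)
    rw [← hi]
    exact hsub i

theorem Subequiv.transports (h : Subequiv G A B) (hA : IsClosed A) : Transports G A B := by
  obtain ⟨𝒰, s, hU, hcov, hd, hsub⟩ := h A hA subset_rfl
  refine Transports.of_finite (ι := 𝒰) (fun U => U.1) (fun U => s U.1) (fun U => hU _ U.2) ?_
    (fun U V hUV => hd U.2 V.2 fun e => hUV (Subtype.ext e)) fun U => hsub _ U.2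
  rwa [Set.iUnion_subtype]

end Transports

theorem Transports.iUnion {G X ι : Type*} [Group G] [TopologicalSpace X] [MulAction G X] [Finite ι]
    {C B : ι → Set X} (h : ∀ i, Transports G (C i) (B i))
    (hB : Pairwise fun i j => Disjoint (B i) (B j)) : Transports G (⋃ i, C i) (⋃ i, B i) := by
  choose κ hκ U s hU hcov hd hsub using h
  refine Transports.of_finite (ι := Σ i, κ i) (fun p => U p.1 p.2) (fun p => s p.1 p.2)
    (fun p => hU _ _) ?_ ?_ fun p => (hsub p.1 p.2).trans (Set.subset_iUnion B p.1)
  · rw [Set.iUnion_sigma]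
    exact Set.iUnion_mono hcov
  · rintro ⟨i, a⟩ ⟨j, b⟩ hne
    rcases eq_or_ne i j with rfl | hij
    · exact hd i fun e => hne (congrArg (Sigma.mk i) e)
    · exact (hB hij).mono (hsub i a) (hsub j b)

/-! ### Comparison inside a single tower. -/

section Tower

variable {G Y : Type*} [Group G] [MetricSpace Y] [MulAction G Y] [ContinuousConstSMul G Y]

/-- At a base point `z`, Hall's condition is trivial: the pieces over `z` inject into the levels of
`z` lying in `B k`. Such an injection can be kept constant on small open sets, and separate colours
prevent overlapping sets from competing for the same levels. -/
theorem transports_of_tower {d : ℕ} (hdim : CoveringDimLE Y d) {W : Set Y} {S : Finset G}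
    (hWS : IsTower W S) (hW : IsOpen W) {Q : Type*} [Finite Q] (g : Q → G) (C : Q → Set Y)
    (hC : ∀ q, IsClosed (C q)) (hCW : ∀ q, g q • C q ⊆ W) {B : Fin (d + 1) → Set Y}
    (hB : ∀ k, IsOpen (B k)) (hBd : Pairwise fun k l => Disjoint (B k) (B l))
    (hcount : ∀ z ∈ W, ∀ k, {q | z ∈ g q • C q}.ncard ≤ {s ∈ (S : Set G) | s • z ∈ B k}.ncard) :
    Transports G (⋃ q, C q) ((⋃ k, B k) ∩ (S : Set G) • W) := by
  classical
  -- A pattern bounds from above the pieces over `z` and from below the levels in each `B k`; both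
  -- conditions are open.
  let P := Set Q × (Fin (d + 1) → Set S)
  let good : Set P := {p | ∀ k, p.1.ncard ≤ ((↑) '' p.2 k : Set G).ncard}
  let O : P → Set Y := fun p =>
    W ∩ ((⋂ q : Q, ⋂ _ : q ∉ p.1, (g q • C q)ᶜ) ∩
      ⋂ k, ⋂ s : S, ⋂ _ : s ∈ p.2 k, (s : G)⁻¹ • B k)
  have hO : ∀ p, IsOpen (O p) := fun p => by
    refine hW.inter (IsOpen.inter ?_ ?_)
    · exact isOpen_iInter_of_finite fun q => isOpen_iInter_of_finite fun _ =>
        ((hC q).smul (g q)).isOpen_compl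
    · exact isOpen_iInter_of_finite fun k => isOpen_iInter_of_finite fun s =>
        isOpen_iInter_of_finite fun _ => (hB k).smul _
  let κ : Set Y := ⋃ q, g q • C q
  have hκ : IsClosed κ := isClosed_iUnion_of_finite fun q => (hC q).smul (g q)
  have hκO : ∀ z ∈ κ, ∃ p ∈ good, z ∈ O p := fun z hz => by
    obtain ⟨q₀, hq₀⟩ := Set.mem_iUnion.1 hz
    have hzW := hCW q₀ hq₀
    refine ⟨({q | z ∈ g q • C q}, fun k => {s | (s : G) • z ∈ B k}), fun k => ?_, hzW, ?_, ?_⟩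
    · convert hcount z hzW k using 2
      ext s
      simp [and_comm]
    · simp
    · simp [Set.mem_inv_smul_set_iff]
  -- `κᶜ` only completes the cover of `Y`; members not inside some good `O p` are discarded in `𝒲'`.
  obtain ⟨𝒲, hfin, href, hdisj, hcov⟩ := hdim.exists_coloring (𝒪 := O '' good ∪ {κᶜ})
    ((good.toFinite.image O).union (Set.finite_singleton _))
    (by
      rintro U (⟨p, -, rfl⟩ | rfl)
      exacts [hO p, hκ.isOpen_compl])
    (by
      refine Set.eq_univ_of_forall fun z => ?_
      by_cases hz : z ∈ κ
      · obtain ⟨p, hp, hzp⟩ := hκO z hz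
        exact ⟨O p, Or.inl ⟨p, hp, rfl⟩, hzp⟩
      · exact ⟨κᶜ, Or.inr rfl, hz⟩)
  let 𝒲' : Fin (d + 1) → Set (Set Y) := fun k => {M ∈ 𝒲 k | ∃ p ∈ good, M ⊆ O p}
  have hfin' : ∀ k, Finite (𝒲' k) := fun k => ((hfin k).subset fun M hM => hM.1).to_subtype
  have hdata : ∀ k, ∀ M : 𝒲' k, ∃ (D : Set Q) (ψ : Q → G), Set.InjOn ψ D ∧
      (∀ q ∈ D, ψ q ∈ S ∧ ψ q • (M : Set Y) ⊆ B k) ∧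
      (∀ z ∈ (M : Set Y), ∀ q, z ∈ g q • C q → q ∈ D) ∧ (M : Set Y) ⊆ W := by
    rintro k ⟨M, hM, p, hp, hMp⟩
    obtain ⟨ψ, hψ, hinj⟩ := (p.1.toFinite).exists_injOn_of_encard_le
      (t := ((↑) '' p.2 k : Set G)) (by
        rw [← p.1.toFinite.cast_ncard_eq, ← (Set.toFinite _).cast_ncard_eq]
        exact_mod_cast hp k)
    refine ⟨p.1, ψ, hinj, fun q hq => ?_, fun z hz q hzq => ?_, fun z hz => (hMp hz).1⟩
    · obtain ⟨s, hs, hsψ⟩ := hψ hq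
      refine ⟨hsψ ▸ s.2, ?_⟩
      rintro _ ⟨z, hz, rfl⟩
      have := Set.mem_iInter.1 (Set.mem_iInter₂.1 (hMp hz).2.2 k s) hs
      rw [Set.mem_inv_smul_set_iff, hsψ] at this
      exact this
    · by_contra hq
      exact Set.mem_iInter₂.1 (hMp hz).2.1 q hq hzq
  choose D ψ hinj hψ hD hMW using hdata
  have key : ∀ x : G, ∀ M : Set Y, ∀ q, (x * g q) • (g q)⁻¹ • M = x • M := fun x M q => by
    rw [mul_smul, smul_inv_smul]
  -- The part of piece `q` over `M` goes down to the base by `g q`, then up to level `ψ q`.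
  refine Transports.of_finite (ι := Σ k, Σ M : 𝒲' k, D k M) (fun a => (g a.2.2)⁻¹ • (a.2.1 : Set Y))
    (fun a => ψ a.1 a.2.1 a.2.2 * g a.2.2) ?_ ?_ ?_ ?_
  · rintro ⟨k, M, q⟩
    exact (href k M M.2.1).1.smul _
  · refine Set.iUnion_subset fun q y hy => ?_
    have hz : g q • y ∈ g q • C q := Set.smul_mem_smul_set hy
    obtain ⟨k, M, hM, hzM⟩ := hcov (g q • y)
    have hM' : M ∈ 𝒲' k := by
      obtain ⟨-, U, (⟨p, hp, rfl⟩ | rfl), hMU⟩ := href k M hM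
      · exact ⟨hM, p, hp, hMU⟩
      · exact absurd (Set.mem_iUnion.2 ⟨q, hz⟩) (hMU hzM)
    exact Set.mem_iUnion.2 ⟨⟨k, ⟨M, hM'⟩, ⟨q, hD k ⟨M, hM'⟩ _ hzM q hz⟩⟩,
      Set.mem_inv_smul_set_iff.2 hzM⟩
  · rintro ⟨k, M, q⟩ ⟨l, M', q'⟩ hne
    simp only [key]
    have h1 := hψ k M q q.2
    have h2 := hψ l M' q' q'.2
    -- Different colours are separated by the `B k`, different levels by the tower, different `M` by
    -- the colouring; equal `M` and level force equal `q` by injectivity.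
    rcases eq_or_ne k l with rfl | hkl
    · by_cases hs : ψ k M q = ψ k M' q'
      · rcases eq_or_ne M M' with rfl | hMM
        · exact absurd (Subtype.ext (hinj k M q.2 q'.2 hs)) fun e => hne (by rw [e])
        · rw [hs]
          refine (Set.disjoint_smul_set).2 ?_
          exact hdisj k M.2.1 M'.2.1 fun e => hMM (Subtype.ext e)
      · exact (hWS h1.1 h2.1 hs).mono (Set.smul_set_mono (hMW k M)) (Set.smul_set_mono (hMW k M'))
    · exact (hBd hkl).mono h1.2 h2.2
  · rintro ⟨k, M, q⟩
    simp only [key]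
    have h1 := hψ k M q q.2
    exact Set.subset_inter (h1.2.trans (Set.subset_iUnion B k))
      ((Set.smul_set_mono (hMW k M)).trans (Set.smul_set_subset_smul h1.1))

end Tower

/-! ### Pulling castles back along an extension. -/

section Extension

variable {G X Y : Type*} [Group G] [MulAction G X] [MulAction G Y]

theorem IsExtension.preimage_smul [TopologicalSpace X] [TopologicalSpace Y] {π : Y → X}
    (hπ : IsExtension G π) (g : G) (A : Set X) : π ⁻¹' (g • A) = g • π ⁻¹' A := by
  ext y
  rw [Set.mem_preimage, Set.mem_smul_set_iff_inv_smul_mem, Set.mem_smul_set_iff_inv_smul_mem,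
    Set.mem_preimage, hπ.equivariant]

theorem IsExtension.preimage_set_smul [TopologicalSpace X] [TopologicalSpace Y] {π : Y → X}
    (hπ : IsExtension G π) (S : Set G) (A : Set X) : π ⁻¹' (S • A) = S • π ⁻¹' A := by
  simp only [← Set.iUnion_smul_set, Set.preimage_iUnion, hπ.preimage_smul]

theorem IsExtension.isCastle_preimage [TopologicalSpace X] [TopologicalSpace Y] {π : Y → X}
    (hπ : IsExtension G π) {ι : Type*} {V : ι → Set X} {S : ι → Finset G} (h : IsCastle V S) :
    IsCastle (fun i => π ⁻¹' V i) S where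
  tower i s hs t ht hst := by
    have := (h.tower i hs ht hst).preimage π
    simpa only [Function.onFun, hπ.preimage_smul] using this
  disjoint i j hij := by
    have := (h.disjoint hij).preimage π
    simpa only [hπ.preimage_set_smul] using this

theorem IsInvariantShape.mono {K K' : Finset G} {δ δ' : ℝ} {F : Finset G}
    (h : IsInvariantShape K δ F) (hK : K' ⊆ K) (hδ : δ ≤ δ') : IsInvariantShape K' δ' F :=
  ⟨h.1, fun t ht => (h.2 t (hK ht)).trans_le (by gcongr)⟩

theorem isOpen_set_smul_of_isOpen [TopologicalSpace X] [ContinuousConstSMul G X] (S : Set G)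
    {V : Set X} (hV : IsOpen V) : IsOpen (S • V) := by
  rw [← Set.iUnion_smul_set]
  exact isOpen_biUnion fun s _ => hV.smul s

end Extension

/-! ### Absorbing a closed null set. -/

section Comparison

variable {G X Y : Type*} [Group G]
    [MetricSpace X] [MulAction G X] [ContinuousConstSMul G X]
    [MetricSpace Y] [CompactSpace Y] [MulAction G Y] [ContinuousConstSMul G Y]
    [MeasurableSpace Y] [BorelSpace Y]

theorem transports_of_null (haf : AlmostFinite G X) {π : Y → X} (hπ : IsExtension G π)
    {d : ℕ} (hdim : CoveringDimLE Y d) {N : Set Y} (hN : IsClosed N)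
    (hnull : ∀ μ ∈ invariantMeasures G Y, μ N = 0) {B : Fin (d + 1) → Set Y}
    (hB : ∀ k, IsOpen (B k)) (hBd : Pairwise fun k l => Disjoint (B k) (B l))
    {c : ℝ} (hc : 0 < c) (hBc : ∀ μ ∈ invariantMeasures G Y, ∀ k, c ≤ μ.real (B k)) :
    Transports G N (⋃ k, B k) := by
  classical
  have hBk : ∀ k, ∃ (K : Finset G) (δ : ℝ), 0 < δ ∧ ∀ F : Finset G, IsInvariantShape K δ F →
      ∀ y : Y, (({s ∈ (F : Set G) | s • y ∈ (B k)ᶜ}.ncard : ℕ) : ℝ) < (1 - c / 2) * F.card :=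
    fun k => exists_invariantShape_visits_lt (hB k).isClosed_compl fun μ hμ => by
      have := hμ.1
      rw [probReal_compl_eq_one_sub (hB k).measurableSet]
      linarith [hBc μ hμ k]
  choose K δ hδ hvis using hBk
  obtain ⟨K₀, δ₀, hδ₀, hvis₀⟩ := exists_invariantShape_visits_lt (G := G) hN (ε := c / 4)
    fun μ hμ => by
      rw [measureReal_def, hnull μ hμ, ENNReal.toReal_zero]
      positivity
  -- Budget per tower: more than `c / 2` of the levels lie in `B k`, while visits to `N` and the set
  -- `S'` take less than `c / 4` each.
  obtain ⟨n, hn⟩ := exists_nat_one_div_lt (show 0 < c / 4 by positivity)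
  let δ₁ : ℝ := min δ₀ (Finset.univ.inf' Finset.univ_nonempty δ)
  have hδ₁ : 0 < δ₁ := lt_min hδ₀ ((Finset.lt_inf'_iff _).2 fun k _ => hδ k)
  obtain ⟨ι, hι, V, S, S', hcastle, hV, hinv, -, hS', hcard, hrem⟩ :=
    haf (n + 1) n.succ_pos (K₀ ∪ Finset.univ.biUnion K) δ₁ hδ₁
  have hRo : IsOpen (⋃ i, (S i : Set G) • V i) :=
    isOpen_iUnion fun i => isOpen_set_smul_of_isOpen _ (hV i)
  obtain ⟨α, hα, U, t, hU, hUcov, hUd, hUsub⟩ := hrem.transports hRo.isClosed_compl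
  have hcY := hπ.isCastle_preimage hcastle
  have hW : ∀ i, IsOpen (π ⁻¹' V i) := fun i => (hV i).preimage hπ.continuous
  -- Pieces are of two kinds: points in level `s`, and remainder points in `U a` that `t a` sends to
  -- level `s ∈ S'`. `g` brings either kind to the base.
  let Q : ι → Type _ := fun i => S i ⊕ (α × S' i)
  let g : ∀ i, Q i → G := fun i => Sum.elim (fun s => (s : G)⁻¹) fun p => (p.2 : G)⁻¹ * t p.1
  let A : (Σ i, Q i) → Set Y := fun q => ((g q.1 q.2)⁻¹ • π ⁻¹' V q.1) ∩
    Sum.elim (fun _ => Set.univ) (fun p => π ⁻¹' U p.1) q.2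
  have hA : ∀ q, IsOpen (A q) := by
    rintro ⟨i, s | p⟩
    · exact ((hW i).smul _).inter isOpen_univ
    · exact ((hW i).smul _).inter ((hU p.1).preimage hπ.continuous)
  have hAcov : ∀ y, ∃ q, y ∈ A q := fun y => by
    by_cases hy : π y ∈ ⋃ i, (S i : Set G) • V i
    · obtain ⟨i, s, hs, v, hv, hsv⟩ := Set.mem_iUnion.1 hy
      refine ⟨⟨i, Sum.inl ⟨s, hs⟩⟩, ?_, trivial⟩
      rw [Set.mem_inv_smul_set_iff]
      change π (s⁻¹ • y) ∈ V i
      rw [hπ.equivariant, ← hsv]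
      simpa using hv
    · obtain ⟨a, ha⟩ := Set.mem_iUnion.1 (hUcov hy)
      obtain ⟨i, s, hs, v, hv, hsv⟩ :=
        Set.mem_iUnion.1 (hUsub a (Set.smul_mem_smul_set ha))
      refine ⟨⟨i, Sum.inr (a, ⟨s, hs⟩)⟩, ?_, ha⟩
      rw [Set.mem_inv_smul_set_iff]
      change π ((s⁻¹ * t a) • y) ∈ V i
      rw [hπ.equivariant, mul_smul, ← hsv]
      simpa using hv
  -- The open cover is shrunk to a closed one, as `transports_of_tower` needs closed pieces.
  obtain ⟨C, hNC, hC, hCA⟩ := exists_subset_iUnion_closed_subset hN hA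
    (fun y _ => Set.toFinite _) (fun y _ => Set.mem_iUnion.2 (hAcov y))
  have hAW : ∀ i q, g i q • (C ⟨i, q⟩ ∩ N) ⊆ π ⁻¹' V i := fun i q => by
    rw [Set.smul_set_subset_iff_subset_inv_smul_set]
    exact Set.inter_subset_left.trans ((hCA ⟨i, q⟩).trans Set.inter_subset_left)
  have htower : ∀ i, Transports G (⋃ q, (C ⟨i, q⟩ ∩ N))
      ((⋃ k, B k) ∩ (S i : Set G) • π ⁻¹' V i) := fun i => by
    refine transports_of_tower hdim (hcY.tower i) (hW i) (g i) _ (fun q => (hC _).inter hN)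
      (hAW i) hB hBd fun z hz k => ?_
    have hSinv := hinv i
    have hv₀ := hvis₀ (S i) (hSinv.mono Finset.subset_union_left (min_le_left _ _)) z
    have hvk := hvis k (S i) (hSinv.mono
      ((Finset.subset_biUnion_of_mem K (Finset.mem_univ k)).trans Finset.subset_union_right)
      ((min_le_right _ _).trans (Finset.inf'_le _ (Finset.mem_univ k)))) z
    have hle : {q | z ∈ g i q • (C ⟨i, q⟩ ∩ N)}.ncard ≤
        {s ∈ (S i : Set G) | s • z ∈ N}.ncard + (S' i).card := by
      -- Forgetting `a` is injective over `z`, because the sets `t a • U a` are disjoint; so the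
      -- second kind contributes at most `|S'|`.
      let f : Q i → G ⊕ G := Sum.map (fun s => s) fun p => p.2
      have h1 : {q | z ∈ g i q • (C ⟨i, q⟩ ∩ N)}.ncard ≤
          (Sum.inl '' {s ∈ (S i : Set G) | s • z ∈ N} ∪ Sum.inr '' (S' i : Set G) :
            Set (G ⊕ G)).ncard := by
        refine Set.ncard_le_ncard_of_injOn f ?_ ?_
          ((((S i).finite_toSet.subset (Set.sep_subset _ _)).image _).union
            ((S' i).finite_toSet.image _))
        · rintro (s | p) hq
          · refine Or.inl ⟨s, ⟨s.2, ?_⟩, rfl⟩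
            have := (Set.mem_smul_set_iff_inv_smul_mem.1 hq).2
            simpa [g] using this
          · exact Or.inr ⟨p.2, p.2.2, rfl⟩
        · rintro (s | ⟨a, s⟩) hq (s' | ⟨a', s'⟩) hq' hf
          · exact congrArg Sum.inl (by simpa [f] using hf)
          · simp [f] at hf
          · simp [f] at hf
          · obtain rfl : s = s' := by simpa [f] using hf
            suffices a = a' by rw [this]
            by_contra hne
            have h2 : ∀ b : α, z ∈ g i (Sum.inr (b, s)) • (C ⟨i, Sum.inr (b, s)⟩ ∩ N) →
                π ((s : G) • z) ∈ t b • U b := fun b hb => by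
              have := (hCA _ (Set.mem_smul_set_iff_inv_smul_mem.1 hb).1).2
              rw [Set.mem_smul_set_iff_inv_smul_mem, ← hπ.equivariant, ← mul_smul]
              simpa [g] using this
            exact Set.disjoint_left.1 (hUd hne) (h2 a hq) (h2 a' hq')
      refine h1.trans ((Set.ncard_union_le _ _).trans ?_)
      rw [Set.ncard_image_of_injective _ Sum.inl_injective,
        Set.ncard_image_of_injective _ Sum.inr_injective, Set.ncard_coe_finset]
    have hcompl : {s ∈ (S i : Set G) | s • z ∈ (B k)ᶜ}.ncard +
        {s ∈ (S i : Set G) | s • z ∈ B k}.ncard = (S i).card := by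
      rw [← Set.ncard_coe_finset (S i), ← Set.ncard_union_eq _
        ((S i).finite_toSet.subset (Set.sep_subset _ _))
        ((S i).finite_toSet.subset (Set.sep_subset _ _))]
      · congr 1
        ext s
        simp only [Set.mem_union, Set.mem_ofPred, Set.mem_compl_iff]
        tauto
      · exact Set.disjoint_left.2 fun s h h' => h.2 h'.2
    have hS'c : ((S' i).card : ℝ) < c / 4 * (S i).card := by
      refine (hcard i).trans_le ?_
      rw [div_eq_inv_mul]
      gcongr
      push_cast
      rw [← one_div]
      exact hn.le
    have hleR : ({q | z ∈ g i q • (C ⟨i, q⟩ ∩ N)}.ncard : ℝ) ≤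
        ({s ∈ (S i : Set G) | s • z ∈ N}.ncard : ℝ) + (S' i).card := by exact_mod_cast hle
    have hcR : ({s ∈ (S i : Set G) | s • z ∈ (B k)ᶜ}.ncard : ℝ) +
        ({s ∈ (S i : Set G) | s • z ∈ B k}.ncard : ℝ) = (S i).card := by exact_mod_cast hcompl
    have : ({q | z ∈ g i q • (C ⟨i, q⟩ ∩ N)}.ncard : ℝ) ≤
        ({s ∈ (S i : Set G) | s • z ∈ B k}.ncard : ℝ) := by linarith
    exact_mod_cast this
  refine (Transports.iUnion htower fun i j hij => ?_).mono ?_ ?_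
  · exact (hcY.disjoint hij).mono Set.inter_subset_right Set.inter_subset_right
  · intro y hy
    obtain ⟨⟨i, q⟩, hq⟩ := Set.mem_iUnion.1 (hNC hy)
    exact Set.mem_iUnion.2 ⟨i, Set.mem_iUnion.2 ⟨q, hq, hy⟩⟩
  · exact Set.iUnion_subset fun i => Set.inter_subset_left

end Comparison

/-! ### Size of shapes and lower bounds on measure. -/

/-- If `|F| < L`, the symmetric differences have fewer than one element, so `K` preserves `F` and `t
↦ t * f` injects `K` into `F`. -/
theorem IsInvariantShape.le_card {G : Type*} [Group G] {K F : Finset G} {δ : ℝ} {L : ℕ}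
    (h : IsInvariantShape K δ F) (hδ : δ * L ≤ 1) (hK : L ≤ K.card) : L ≤ F.card := by
  classical
  obtain ⟨⟨f, hf⟩, hinv⟩ := h
  by_contra! hlt
  have hmem : ∀ t ∈ K, t * f ∈ F := fun t ht => by
    have h1 := hinv t ht
    rw [← Finset.coe_smul_finset, ← Finset.coe_symmDiff, Set.ncard_coe_finset] at h1
    have hδ0 : 0 < δ := by
      by_contra! h0
      have : δ * F.card ≤ 0 := mul_nonpos_of_nonpos_of_nonneg h0 (Nat.cast_nonneg _)
      linarith [(Nat.cast_nonneg (symmDiff (t • F) F).card : (0 : ℝ) ≤ _)]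
    have h2 : ((symmDiff (t • F) F).card : ℝ) < 1 :=
      h1.trans_le ((mul_le_mul_of_nonneg_left (by exact_mod_cast hlt.le) hδ0.le).trans hδ)
    have h3 : symmDiff (t • F) F = ∅ :=
      Finset.card_eq_zero.1 (Nat.lt_one_iff.1 (by exact_mod_cast h2))
    rw [← Finset.bot_eq_empty, symmDiff_eq_bot] at h3
    rw [← h3]
    exact Finset.smul_mem_smul_finset hf
  have := Finset.card_le_card_of_injOn (fun t => t * f) hmem (mul_left_injective f).injOn
  omega

theorem IsCastle.disjoint_smul {G X ι : Type*} [Group G] [MulAction G X] {V : ι → Set X}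
    {S : ι → Finset G} (h : IsCastle V S) {i j : ι} {s t : G} (hs : s ∈ S i) (ht : t ∈ S j)
    (hne : i = j → s ≠ t) : Disjoint (s • V i) (t • V j) := by
  rcases eq_or_ne i j with rfl | hij
  · exact h.tower i hs ht (hne rfl)
  · exact (h.disjoint hij).mono (Set.smul_set_subset_smul hs) (Set.smul_set_subset_smul ht)

theorem measureReal_ge_of_translates_cover {G Y α : Type*} [Group G] [TopologicalSpace Y]
    [MeasurableSpace Y] [MulAction G Y] [Fintype α] {μ : Measure Y}
    (hμ : μ ∈ invariantMeasures G Y) {N B : Set Y} (hN : μ N = 0) (g : α → G)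
    (hcov : Set.univ ⊆ N ∪ ⋃ a, g a • B) : (1 : ℝ) / (Fintype.card α + 1) ≤ μ.real B := by
  have := hμ.1
  have := hμ.2.2
  have h1 : (1 : ℝ) ≤ Fintype.card α * μ.real B := by
    calc (1 : ℝ) = μ.real Set.univ := by simp
      _ ≤ μ.real (N ∪ ⋃ a, g a • B) := measureReal_mono hcov
      _ ≤ μ.real N + μ.real (⋃ a, g a • B) := measureReal_union_le _ _
      _ ≤ μ.real N + ∑ a, μ.real (g a • B) := by
          gcongr
          exact measureReal_iUnion_fintype_le _
      _ = Fintype.card α * μ.real B := by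
          simp [measureReal_def, hN, measure_smul]
  rw [div_le_iff₀ (by positivity)]
  nlinarith [measureReal_nonneg (μ := μ) (s := B)]

/-! ### The refined castle and the final construction. -/

section Extension

variable {G X Y : Type*} [Group G]
    [MetricSpace X] [MulAction G X] [ContinuousConstSMul G X]
    [MetricSpace Y] [CompactSpace Y] [MulAction G Y] [ContinuousConstSMul G Y]
    [MeasurableSpace Y] [BorelSpace Y]

theorem exists_castle_of_isExtension (haf : AlmostFinite G X) {π : Y → X}
    (hπ : IsExtension G π) (hE : (ergodicMeasures G Y).Finite) {n : ℕ} (hn : 0 < n)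
    (K : Finset G) {δ : ℝ} (hδ : 0 < δ) (ε : ℝ) (hε : 0 < ε) :
    ∃ (ι : Type) (_ : Finite ι) (V : ι → Set Y) (S S' : ι → Finset G) (D N : Set Y),
      IsCastle V S ∧ (∀ i, IsOpen (V i)) ∧ (∀ i, IsInvariantShape K δ (S i)) ∧
      (∀ i, ∀ s ∈ S i, Metric.diam (s • V i) < ε) ∧ (∀ i, S' i ⊆ S i) ∧
      (∀ i, ((S' i).card : ℝ) < (S i).card / n) ∧
      (⋃ i, (S i : Set G) • V i)ᶜ ⊆ D ∪ N ∧ IsClosed N ∧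
      (∀ μ ∈ invariantMeasures G Y, μ N = 0) ∧
      Transports G D (⋃ i, (S' i : Set G) • V i) := by
  obtain ⟨m, P, hPo, hPd, hPdiam, hPnull⟩ := exists_null_partition hE hε
  obtain ⟨ι, hι, V, S, S', hcastle, hV, hinv, -, hS', hcard, hrem⟩ := haf n hn K δ hδ
  have hRo : IsOpen (⋃ i, (S i : Set G) • V i) :=
    isOpen_iUnion fun i => isOpen_set_smul_of_isOpen _ (hV i)
  obtain ⟨α, hα, U, t, hU, hUcov, hUd, hUsub⟩ := hrem.transports hRo.isClosed_compl
  have hcY := hπ.isCastle_preimage hcastle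
  have hW : ∀ i, IsOpen (π ⁻¹' V i) := fun i => (hV i).preimage hπ.continuous
  -- Itineraries through the partition. `Fin (S i).card` replaces `S i` to stay in `Type`, whatever
  -- the universe of `G`.
  let κ : Type := Σ i, (Fin (S i).card → Fin m)
  let T : κ → Set Y := fun a =>
    π ⁻¹' V a.1 ∩ ⋂ s : S a.1, (s : G)⁻¹ • P (a.2 ((S a.1).equivFin s))
  have hT : ∀ a, IsOpen (T a) := fun a =>
    (hW a.1).inter (isOpen_iInter_of_finite fun s => (hPo _).smul _)
  have hTP : ∀ a, ∀ s (hs : s ∈ S a.1), s • T a ⊆ P (a.2 ((S a.1).equivFin ⟨s, hs⟩)) := by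
    intro a s hs
    rw [Set.smul_set_subset_iff_subset_inv_smul_set]
    exact Set.inter_subset_right.trans (Set.iInter_subset _ (⟨s, hs⟩ : S a.1))
  have hTW : ∀ a, T a ⊆ π ⁻¹' V a.1 := fun a => Set.inter_subset_left
  have hTcastle : IsCastle T fun a => S a.1 := by
    refine ⟨fun a s hs r hr hsr => ?_, ?_⟩
    · exact (hcY.tower a.1 hs hr hsr).mono (Set.smul_set_mono (hTW a)) (Set.smul_set_mono (hTW a))
    · rintro ⟨i, f⟩ ⟨j, f'⟩ hne
      rw [Set.disjoint_left]
      rintro _ ⟨s, hs, v, hv, rfl⟩ ⟨r, hr, w, hw, hrw⟩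
      have hd := fun h => Set.disjoint_left.1 (hcY.disjoint_smul (i := i) (j := j) hs hr h)
        (Set.smul_mem_smul_set (hTW _ hv))
        ((show r • w = s • v from hrw) ▸ Set.smul_mem_smul_set (hTW _ hw))
      have hij : i = j ∧ s = r := by
        by_contra hcon
        exact hd fun h h' => hcon ⟨h, h'⟩
      obtain ⟨rfl, rfl⟩ := hij
      obtain rfl : w = v := smul_left_cancel _ hrw
      obtain ⟨l, hl⟩ := Function.ne_iff.1 fun e : f = f' => hne (by rw [e])
      obtain ⟨⟨q, hq⟩, rfl⟩ := (S i).equivFin.surjective l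
      exact Set.disjoint_left.1 (hPd hl) (hTP ⟨i, f⟩ q hq (Set.smul_mem_smul_set hv))
        (hTP ⟨i, f'⟩ q hq (Set.smul_mem_smul_set hw))
  let Z : Set Y := (⋃ l, P l)ᶜ
  have hZ : IsClosed Z := (isOpen_iUnion hPo).isClosed_compl
  -- A point `y` of level `s` has no itinerary exactly when some `r s⁻¹ y` falls in `Z`.
  let N₀ : Set Y := ⋃ i, ⋃ s : S i, ⋃ r : S i, ((s : G) * (r : G)⁻¹) • Z
  have hN₀ : IsClosed N₀ := isClosed_iUnion_of_finite fun i => isClosed_iUnion_of_finite fun s =>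
    isClosed_iUnion_of_finite fun r => hZ.smul _
  have hN₀null : ∀ μ ∈ invariantMeasures G Y, μ N₀ = 0 := fun μ hμ => by
    have := hμ.2.2
    have : Countable ι := Finite.to_countable
    refine measure_iUnion_null fun i => measure_iUnion_null fun s => measure_iUnion_null fun r => ?_
    rw [measure_smul]
    exact hPnull μ hμ
  have hlevel : ∀ i, ∀ s ∈ S i, ∀ y, π y ∈ s • V i → y ∉ N₀ → ∃ f, y ∈ s • T ⟨i, f⟩ := by
    intro i s hs y hy hyN
    rw [Set.mem_smul_set_iff_inv_smul_mem, ← hπ.equivariant] at hy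
    have hP : ∀ r : S i, ∃ l, (r : G) • s⁻¹ • y ∈ P l := fun r => by
      by_contra hcon
      refine hyN (Set.mem_iUnion.2 ⟨i, Set.mem_iUnion₂.2 ⟨⟨s, hs⟩, r, ?_⟩⟩)
      rw [Set.mem_smul_set_iff_inv_smul_mem, mul_inv_rev, inv_inv, mul_smul]
      exact fun h => hcon (Set.mem_iUnion.1 h)
    choose l hl using hP
    refine ⟨fun q => l ((S i).equivFin.symm q), ?_⟩
    rw [Set.mem_smul_set_iff_inv_smul_mem]
    refine ⟨hy, Set.mem_iInter.2 fun r => ?_⟩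
    rw [Set.mem_inv_smul_set_iff]
    simpa using hl r
  -- `D` is the set of points whose transport from `X` lands in a refined `S'` level; failures lie
  -- in `N₀` or in some `(t a)⁻¹ • N₀`.
  refine ⟨κ, inferInstance, T, fun a => S a.1, fun a => S' a.1,
    ⋃ a, (π ⁻¹' U a ∩ (t a)⁻¹ • ⋃ b : κ, (S' b.1 : Set G) • T b), N₀ ∪ ⋃ a, (t a)⁻¹ • N₀,
    hTcastle, hT, fun a => hinv a.1, fun a s hs => ?_, fun a => hS' a.1, fun a => hcard a.1,
    fun y hy => ?_, hN₀.union (isClosed_iUnion_of_finite fun a => hN₀.smul _), fun μ hμ => ?_, ?_⟩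
  · exact (Metric.diam_mono (hTP a s hs) (Metric.isBounded_of_compactSpace)).trans_lt (hPdiam _)
  · by_contra hcon
    simp only [Set.mem_union, not_or] at hcon
    obtain ⟨h1, h2, h3⟩ := hcon
    by_cases hR : π y ∈ ⋃ i, (S i : Set G) • V i
    · obtain ⟨i, s, hs, v, hv, hsv⟩ := Set.mem_iUnion.1 hR
      obtain ⟨f, hf⟩ := hlevel i s hs y (hsv ▸ Set.smul_mem_smul_set hv) h2
      exact hy (Set.mem_iUnion.2 ⟨⟨i, f⟩, Set.smul_set_subset_smul hs hf⟩)
    · obtain ⟨a, ha⟩ := Set.mem_iUnion.1 (hUcov hR)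
      refine h1 (Set.mem_iUnion.2 ⟨a, ha, ?_⟩)
      obtain ⟨i, s, hs, v, hv, hsv⟩ := Set.mem_iUnion.1 (hUsub a (Set.smul_mem_smul_set ha))
      have hya : t a • y ∉ N₀ := fun h => h3 (Set.mem_iUnion.2 ⟨a, Set.mem_inv_smul_set_iff.2 h⟩)
      obtain ⟨f, hf⟩ := hlevel i s (hS' i hs) (t a • y)
        (by rw [hπ.equivariant, ← hsv]; exact Set.smul_mem_smul_set hv) hya
      exact Set.mem_inv_smul_set_iff.2
        (Set.mem_iUnion.2 ⟨⟨i, f⟩, Set.smul_set_subset_smul hs hf⟩)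
  · have := hμ.2.2
    have : Countable α := Finite.to_countable
    refine measure_union_null (hN₀null μ hμ) (measure_iUnion_null fun a => ?_)
    rw [measure_smul]
    exact hN₀null μ hμ
  · refine Transports.of_finite _ t (fun a => ?_) subset_rfl (fun a b hab => ?_) fun a => ?_
    · exact ((hU a).preimage hπ.continuous).inter
        ((isOpen_iUnion fun b => isOpen_set_smul_of_isOpen _ (hT b)).smul _)
    · refine Disjoint.mono (Set.smul_set_mono Set.inter_subset_left)
        (Set.smul_set_mono Set.inter_subset_left) ?_
      rw [← hπ.preimage_smul, ← hπ.preimage_smul]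
      exact (hUd hab).preimage π
    · rw [Set.smul_set_subset_iff_subset_inv_smul_set]
      exact Set.inter_subset_right

theorem almostFinite_of_isExtension (haf : AlmostFinite G X) {π : Y → X}
    (hπ : IsExtension G π) (hE : (ergodicMeasures G Y).Finite) (hdim : FiniteCoveringDim Y) :
    AlmostFinite G Y := by
  classical
  obtain ⟨d, hd⟩ := hdim
  intro n hn K δ hδ
  -- For finite `G` the whole group is a shape with less than one visit to `N`, so `N` is empty. For
  -- infinite `G` shapes can be forced to be large.
  rcases finite_or_infinite G with hG | hG
  · have := Fintype.ofFinite G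
    obtain ⟨ι, hι, V, S, S', D, N, hcastle, hV, hinv, hdiam, hS', hcard, hrem, hN, hnull, htr⟩ :=
      exists_castle_of_isExtension haf hπ hE hn K hδ δ hδ
    refine ⟨ι, hι, V, S, S', hcastle, hV, hinv, hdiam, hS', hcard,
      (htr.mono (hrem.trans (Set.union_subset subset_rfl fun y hy => ?_)) subset_rfl).subequiv⟩
    obtain ⟨K₀, δ₀, hδ₀, h₀⟩ := exists_invariantShape_visits_lt (G := G) hN
      (ε := 1 / Fintype.card G) fun μ hμ => by
        rw [measureReal_def, hnull μ hμ, ENNReal.toReal_zero]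
        positivity
    have h1 := h₀ Finset.univ ⟨Finset.univ_nonempty, fun t _ => by
      simpa using mul_pos hδ₀ (Nat.cast_pos.2 Fintype.card_pos : (0 : ℝ) < Fintype.card G)⟩ y
    rw [Finset.card_univ, one_div, inv_mul_cancel₀ (by simp)] at h1
    have h2 : {s ∈ ((Finset.univ : Finset G) : Set G) | s • y ∈ N}.ncard = 0 :=
      Nat.lt_one_iff.1 (by exact_mod_cast h1)
    rw [Set.ncard_eq_zero] at h2
    have : (1 : G) ∈ (∅ : Set G) := h2 ▸ ⟨by simp, by simpa using hy⟩
    exact this.elim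
  -- With `2 * n` in place of `n`, `S'` uses less than half of `|S| / n`; `|S| ≥ L` fits the `d + 1`
  -- reserved levels in the other half.
  · set L : ℕ := 2 * n * (d + 1) with hL
    have hL0 : 0 < L := by positivity
    obtain ⟨K', hK'⟩ := Infinite.exists_subset_card_eq G L
    obtain ⟨ι, hι, V, S, S', D, N, hcastle, hV, hinv, hdiam, hS', hcard, hrem, hN, hnull, htr⟩ :=
      exists_castle_of_isExtension haf hπ hE (show 0 < 2 * n by positivity) (K ∪ K')
        (δ := min δ (1 / L)) (lt_min hδ (by positivity)) δ hδ
    have hSL : ∀ i, L ≤ (S i).card := fun i =>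
      (hinv i).le_card ((mul_le_mul_of_nonneg_right (min_le_right _ _) (Nat.cast_nonneg _)).trans
        (by rw [one_div, inv_mul_cancel₀ (by positivity)]))
        (hK' ▸ Finset.card_le_card Finset.subset_union_right)
    have hbound : ∀ i, ((S' i).card : ℝ) + (d + 1) < (S i).card / n := fun i => by
      have h1 := hcard i
      have h2 : ((d : ℝ) + 1) ≤ (S i).card / (2 * n) := by
        rw [le_div_iff₀ (by positivity)]
        have : (L : ℝ) ≤ (S i).card := by exact_mod_cast hSL i
        rw [hL] at this
        push_cast at this
        linarith
      push_cast at h1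
      have h3 : ((S i).card : ℝ) / n = (S i).card / (2 * n) + (S i).card / (2 * n) := by
        field_simp
        ring
      linarith
    have hτ : ∀ i, Nonempty (Fin (d + 1) ↪ (S i \ S' i : Finset G)) := fun i => by
      refine Function.Embedding.nonempty_of_card_le ?_
      rw [Fintype.card_fin, Fintype.card_coe, Finset.card_sdiff_of_subset (hS' i)]
      have h1 : ((S i).card : ℝ) / n ≤ (S i).card :=
        div_le_self (Nat.cast_nonneg _) (by exact_mod_cast hn)
      have h2 : ((S' i).card : ℝ) + (d + 1) < (S i).card := (hbound i).trans_le h1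
      have h3 : (S' i).card + (d + 1) < (S i).card := by exact_mod_cast h2
      omega
    let τ : ∀ i, Fin (d + 1) ↪ (S i \ S' i : Finset G) := fun i => (hτ i).some
    have hτS : ∀ i k, (τ i k : G) ∈ S i := fun i k => (Finset.mem_sdiff.1 (τ i k).2).1
    have hτS' : ∀ i k, (τ i k : G) ∉ S' i := fun i k => (Finset.mem_sdiff.1 (τ i k).2).2
    let B : Fin (d + 1) → Set Y := fun k => ⋃ i, (τ i k : G) • V i
    have hB : ∀ k, IsOpen (B k) := fun k => isOpen_iUnion fun i => (hV i).smul _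
    have hBd : Pairwise fun k l => Disjoint (B k) (B l) := fun k l hkl => by
      refine Set.disjoint_iUnion_left.2 fun i => Set.disjoint_iUnion_right.2 fun j => ?_
      refine hcastle.disjoint_smul (hτS i k) (hτS j l) ?_
      rintro rfl h
      exact hkl ((τ i).injective (Subtype.ext h))
    have htr' := htr
    obtain ⟨α, hα, U, t, -, hUcov, -, hUsub⟩ := htr'
    have := Fintype.ofFinite (Option α × Σ i, S i)
    -- Off `N`, each point is in a level (`none`) or is moved into one by `t a`; a translate of the
    -- reserved level `τ i k` then covers it, which bounds the measure of `B k` below.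
    let g : ∀ k, (Option α × Σ i, S i) → G := fun k p =>
      p.1.elim 1 (fun a => (t a)⁻¹) * ((p.2.2 : G) * (τ p.2.1 k : G)⁻¹)
    have hcov : ∀ k, Set.univ ⊆ N ∪ ⋃ p, g k p • B k := fun k y _ => by
      have hlev : ∀ i, ∀ s : S i, ∀ z, z ∈ (s : G) • V i →
          z ∈ ((s : G) * (τ i k : G)⁻¹) • B k := fun i s z hz => by
        rw [Set.mem_smul_set_iff_inv_smul_mem] at hz ⊢
        refine Set.mem_iUnion.2 ⟨i, ?_⟩
        rw [Set.mem_smul_set_iff_inv_smul_mem]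
        simpa [mul_smul] using hz
      by_cases hy : y ∈ ⋃ i, (S i : Set G) • V i
      · obtain ⟨i, s, hs, v, hv, rfl⟩ := Set.mem_iUnion.1 hy
        refine Or.inr (Set.mem_iUnion.2 ⟨(none, ⟨i, ⟨s, hs⟩⟩), ?_⟩)
        simpa [g] using hlev i ⟨s, hs⟩ _ (Set.smul_mem_smul_set hv)
      · rcases hrem hy with h | h
        · obtain ⟨a, ha⟩ := Set.mem_iUnion.1 (hUcov h)
          obtain ⟨i, s, hs, v, hv, hsv⟩ := Set.mem_iUnion.1 (hUsub a (Set.smul_mem_smul_set ha))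
          refine Or.inr (Set.mem_iUnion.2 ⟨(some a, ⟨i, ⟨s, hS' i hs⟩⟩), ?_⟩)
          change y ∈ ((t a)⁻¹ * (s * (τ i k : G)⁻¹)) • B k
          rw [mul_smul, Set.mem_inv_smul_set_iff]
          exact hlev i ⟨s, hS' i hs⟩ _ (hsv ▸ Set.smul_mem_smul_set hv)
        · exact Or.inl h
    have hNtr : Transports G N (⋃ k, B k) :=
      transports_of_null haf hπ hd hN hnull hB hBd
        (c := 1 / (Fintype.card (Option α × Σ i, S i) + 1)) (by positivity) fun μ hμ k =>
          measureReal_ge_of_translates_cover hμ (hnull μ hμ) (g k) (hcov k)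
    have hdisj : Disjoint (⋃ i, (S' i : Set G) • V i) (⋃ k, B k) := by
      refine Set.disjoint_iUnion_left.2 fun i => Set.disjoint_iUnion_right.2 fun k =>
        Set.disjoint_iUnion_right.2 fun j => ?_
      rw [← Set.iUnion_smul_set]
      refine Set.disjoint_iUnion₂_left.2 fun s hs => ?_
      refine hcastle.disjoint_smul (hS' i hs) (hτS j k) ?_
      rintro rfl rfl
      exact hτS' i k hs
    refine ⟨ι, hι, V, S, fun i => S' i ∪ Finset.univ.image fun k => (τ i k : G), hcastle, hV,
      fun i => (hinv i).mono Finset.subset_union_left (min_le_left _ _), hdiam, fun i => ?_,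
      fun i => ?_, ((htr.union hNtr hdisj).mono hrem ?_).subequiv⟩
    · refine Finset.union_subset (hS' i) fun s hs => ?_
      obtain ⟨k, -, rfl⟩ := Finset.mem_image.1 hs
      exact hτS i k
    · refine lt_of_le_of_lt ?_ (hbound i)
      have h1 : (S' i ∪ Finset.univ.image fun k => (τ i k : G)).card ≤ (S' i).card + (d + 1) :=
        (Finset.card_union_le _ _).trans
          (Nat.add_le_add_left (Finset.card_image_le.trans (by simp)) _)
      exact_mod_cast h1
    · refine Set.union_subset (Set.iUnion_mono fun i => Set.smul_subset_smul_right ?_)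
        (Set.iUnion_subset fun k => Set.iUnion_mono fun i => Set.smul_set_subset_smul ?_)
      · simp
      · simp

end Extension

theorem IsExtension.isCancelSMul {G X Y : Type*} [Group G] [TopologicalSpace X]
    [TopologicalSpace Y] [MulAction G X] [MulAction G Y] [IsCancelSMul G X] {π : Y → X}
    (hπ : IsExtension G π) : IsCancelSMul G Y where
  left_cancel' g _ _ h := smul_left_cancel g h
  right_cancel' a b y h := by
    have := congrArg π h
    rw [hπ.equivariant, hπ.equivariant] at this
    exact IsCancelSMul.right_cancel a b (π y) this

end TopDyn

theorem mainTheorem9 {G X Y : Type*} [Group G] [Countable G]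
    [MetricSpace X] [CompactSpace X] [MulAction G X] [ContinuousConstSMul G X]
    [MetricSpace Y] [CompactSpace Y] [MulAction G Y] [ContinuousConstSMul G Y]
    [MeasurableSpace Y] [BorelSpace Y]
    (hfree : IsCancelSMul G X) (haf : TopDyn.AlmostFinite G X)
    (π : Y → X) (hπ : TopDyn.IsExtension G π)
    (hE : (TopDyn.ergodicMeasures G Y).Finite)
    (hdim : TopDyn.FiniteCoveringDim Y) :
    IsCancelSMul G Y ∧ TopDyn.AlmostFinite G Y := by
  exact ⟨hπ.isCancelSMul, TopDyn.almostFinite_of_isExtension haf hπ hE hdim⟩
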